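/- Let $N\in\mathbb N$ and let $M_N(\mathbb C)$ be the space of complex $N\times N$ matrices. For $A\in M_N(\mathbb C)$ let $\|A\|_p=(\operatorname{Tr}(|A|^p))^{1/p}$ for $1\le p<\infty$, where $|A|=(A^*A)^{1/2}$, and $\|A\|_\infty=\sup_{\|v\|=1}\|Av\|$; for a linear map $T:M_N(\mathbb C)\to M_N(\mathbb C)$ let $\|T\|_{p\to p}=\sup_{A\ne 0}\|T(A)\|_p/\|A\|_p$. Let $(T_t)_{t\ge 0}$ be a quantum dynamical semigroup on $M_N(\mathbb C)$ (in the Schrödinger picture), that is, a family of linear maps $T_t:M_N(\mathbb C)\to M_N(\mathbb C)$ such that $T_0$ is the identity, $T_{t+s}=T_tT_s$ for all $t,s\ge 0$, $t\mapsto T_t(A)$ is continuous for every $A\in M_N(\mathbb C)$, $\operatorname{Tr}(T_t(A))=\operatorname{Tr}(A)$ for all $A\in M_N(\mathbb C)$ and $t\ge0$, and every $T_t$ is completely positive. Let $\mathcal L$ be its generator, $\mathcal L(x)=\lim_{t\downarrow 0}\frac1t(T_t(x)-x)$. Then the following are equivalent: \begin{itemize} \item there is $p$ with $1<p\le\infty$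 such that $\|T_t\|_{p\to p}\le 1$ for all $t\ge 0$; \item $\|T_t\|_{p\to p}\le 1$ for all $1\le p\le\infty$ and all $t\ge 0$; \item $\mathcal L(I_N)=0$. \end{itemize} In this case $\operatorname{Tr}(x\mathcal L(x))$ is real and $\operatorname{Tr}(x\mathcal L(x))\le 0$ for all Hermitian $x\in M_N(\mathbb C)$. -/

import Mathlib

open Filter Topology
open scoped NNReal ENNReal

noncomputable section

section Schatten

open scoped MatrixOrder

/-- The Schatten `p`-norm on `M_N(ℂ)`, for `1 ≤ p ≤ ∞`: `(Tr |A|^p)^(1/p)` with `|A| = (A* A)^(1/2)`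
if `p < ∞`, and the operator norm of `A` on the Euclidean space `ℂ^N` if `p = ∞`.
Here `|A|^p` is given by the functional calculus; it is positive semidefinite, so that its trace is
real. -/
def schattenNorm {N : ℕ} (p : ℝ≥0∞) (A : Matrix (Fin N) (Fin N) ℂ) : ℝ :=
  if p = ∞ then ‖Matrix.toEuclideanCLM (n := Fin N) (𝕜 := ℂ) A‖
  else (CFC.rpow (CFC.abs A) p.toReal).trace.re ^ (1 / p.toReal)

/-- The norm `‖T‖_{p → p} = sup_{A ≠ 0} ‖T A‖_p / ‖A‖_p`, as an extended nonnegative real. -/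
def schattenOpNorm {N : ℕ} (p : ℝ≥0∞)
    (T : Matrix (Fin N) (Fin N) ℂ →ₗ[ℂ] Matrix (Fin N) (Fin N) ℂ) : ℝ≥0∞ :=
  ⨆ (A : Matrix (Fin N) (Fin N) ℂ) (_ : A ≠ 0),
    ENNReal.ofReal (schattenNorm p (T A)) / ENNReal.ofReal (schattenNorm p A)

end Schatten

section QDS

open scoped MatrixOrder Matrix.Norms.L2Operator CStarAlgebra

/-- Complete positivity of a linear map of the C*-algebra `M_N(ℂ)`, ordered by
`A ≤ B ↔ B - A` positive semidefinite. -/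
def IsCompletelyPositive {N : ℕ}
    (T : Matrix (Fin N) (Fin N) ℂ →ₗ[ℂ] Matrix (Fin N) (Fin N) ℂ) : Prop :=
  ∃ Φ : Matrix (Fin N) (Fin N) ℂ →CP Matrix (Fin N) (Fin N) ℂ, Φ.toLinearMap = T

end QDS

/-- A quantum dynamical semigroup (Schrödinger picture) on `M_N(ℂ)`. As `M_N(ℂ)` is finite
dimensional, weak continuity is continuity for its usual (entrywise) topology. -/
structure IsQDS {N : ℕ}
    (T : ℝ≥0 → Matrix (Fin N) (Fin N) ℂ →ₗ[ℂ] Matrix (Fin N) (Fin N) ℂ) : Prop where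
  map_zero : T 0 = LinearMap.id
  map_add : ∀ t s : ℝ≥0, T (t + s) = T t ∘ₗ T s
  continuous : ∀ A : Matrix (Fin N) (Fin N) ℂ, Continuous fun t : ℝ≥0 => T t A
  trace_map : ∀ (t : ℝ≥0) (A : Matrix (Fin N) (Fin N) ℂ), (T t A).trace = A.trace
  completelyPositive : ∀ t : ℝ≥0, IsCompletelyPositive (T t)

/-- `L` is the generator of `T`: `L x = lim_{t ↓ 0} (T_t x - x) / t` for all `x`. -/
def IsGenerator {N : ℕ}
    (T : ℝ≥0 → Matrix (Fin N) (Fin N) ℂ →ₗ[ℂ] Matrix (Fin N) (Fin N) ℂ)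
    (L : Matrix (Fin N) (Fin N) ℂ →ₗ[ℂ] Matrix (Fin N) (Fin N) ℂ) : Prop :=
  ∀ x : Matrix (Fin N) (Fin N) ℂ,
    Tendsto (fun t : ℝ≥0 => (t : ℝ)⁻¹ • (T t x - x)) (𝓝[>] 0) (𝓝 (L x))

end

/-! ### Complete positivity as a Gram factorization -/

section CompletelyPositive
open scoped MatrixOrder Matrix.Norms.L2Operator CStarAlgebra

/-! Since `L 1 = 0` holds exactly when every `T t` fixes `1`, the equivalence concerns a single
trace-preserving completely positive map `S`.

If `S 1 = 1`, the singular values of `S A` are dominated by a doubly substochastic matrix applied to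
those of `A` (`exists_doubly_substochastic`): positivity of 2×2 block matrices gives a
Cauchy–Schwarz bound, unitality bounds the row sums, trace preservation the column sums. Jensen's
inequality then gives contraction in every Schatten norm.

Conversely, `S 1` is positive with trace `N`. If its `p`-norm is at most that of `1`, it equals `1`
(`eq_one_of_schattenNorm_le`), by strict convexity of `x ^ p` for `1 < p < ∞` and because no
eigenvalue exceeds 1 for `p = ∞`. At `p = 1` only the trace is seen.

The sign of `Tr (x L x)` is contraction at `p = 2`, divided by `t` in the limit. -/

theorem exists_eq_star_mul_self_of_nonneg {A : Type*} [NonUnitalCStarAlgebra A] [PartialOrder A]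
    [StarOrderedRing A] {a : A} (ha : 0 ≤ a) : ∃ b, a = star b * b :=
  CStarAlgebra.nonneg_iff_eq_star_mul_self.mp ha

theorem IsCompletelyPositive.exists_gram {N : ℕ}
    {T : Matrix (Fin N) (Fin N) ℂ →ₗ[ℂ] Matrix (Fin N) (Fin N) ℂ} (hT : IsCompletelyPositive T)
    (X Y : Matrix (Fin N) (Fin N) ℂ) :
    ∃ A B C D : Matrix (Fin N) (Fin N) ℂ,
      T (X * X.conjTranspose) = A.conjTranspose * A + B.conjTranspose * B ∧
      T (X * Y.conjTranspose) = A.conjTranspose * C + B.conjTranspose * D ∧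
      T (Y * X.conjTranspose) = C.conjTranspose * A + D.conjTranspose * B ∧
      T (Y * Y.conjTranspose) = C.conjTranspose * C + D.conjTranspose * D := by
  obtain ⟨Φ, rfl⟩ := hT
  -- `star R * R` is the block matrix with entries `XX*`, `XY*`, `YX*`, `YY*`; the columns of a
  -- factor of its image supply `A, B` and `C, D`.
  let R : CStarMatrix (Fin 2) (Fin 2) (Matrix (Fin N) (Fin N) ℂ) :=
    CStarMatrix.ofMatrix !![X.conjTranspose, Y.conjTranspose; 0, 0]
  have h := Φ.map_cstarMatrix_nonneg' 2 (star R * R) (star_mul_self_nonneg R)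
  obtain ⟨S, hS⟩ := exists_eq_star_mul_self_of_nonneg h
  have key : ∀ i j, Φ.toLinearMap ((star R * R) i j) = (star S * S) i j := fun i j => by
    rw [← hS]; rfl
  refine ⟨S 0 0, S 1 0, S 0 1, S 1 1, ?_, ?_, ?_, ?_⟩
  · simpa [CStarMatrix.mul_apply, CStarMatrix.star_apply, R, Matrix.star_eq_conjTranspose]
      using! key 0 0
  · simpa [CStarMatrix.mul_apply, CStarMatrix.star_apply, R, Matrix.star_eq_conjTranspose]
      using! key 0 1
  · simpa [CStarMatrix.mul_apply, CStarMatrix.star_apply, R, Matrix.star_eq_conjTranspose]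
      using! key 1 0
  · simpa [CStarMatrix.mul_apply, CStarMatrix.star_apply, R, Matrix.star_eq_conjTranspose]
      using! key 1 1

end CompletelyPositive

open Matrix

/-! ### Singular values -/

section SVD
open scoped MatrixOrder ComplexOrder

variable {N : ℕ}

/-- A square matrix `W` with `W W* ≤ 1` and `W* W ≤ 1`. -/
def IsMatrixContraction (W : Matrix (Fin N) (Fin N) ℂ) : Prop :=
  (1 - W * Wᴴ).PosSemidef ∧ (1 - Wᴴ * W).PosSemidef

theorem posSemidef_one_sub_of_isIdempotent {P : Matrix (Fin N) (Fin N) ℂ} (hP : Pᴴ = P)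
    (h : P * P = P) : (1 - P).PosSemidef := by
  have : 1 - P = (1 - P)ᴴ * (1 - P) := by
    simp [hP, sub_mul, mul_sub, h]
  rw [this]
  exact posSemidef_conjTranspose_mul_self _

theorem isMatrixContraction_of_mul_conjTranspose_mul {W : Matrix (Fin N) (Fin N) ℂ}
    (h : W * (Wᴴ * W) = W) : IsMatrixContraction W := by
  constructor
  · apply posSemidef_one_sub_of_isIdempotent (by simp)
    rw [← mul_assoc, mul_assoc W, h]
  · apply posSemidef_one_sub_of_isIdempotent (by simp)
    rw [mul_assoc, h]

/-- Diagonalize `|A| = V D V*` and put `W = A V E`, with `E` the pseudo-inverse of `D`. A partial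
isometry `W` suffices later, so it is not completed to a unitary. -/
theorem exists_singularValue_decomposition (A : Matrix (Fin N) (Fin N) ℂ) :
    ∃ (W V : Matrix (Fin N) (Fin N) ℂ) (d : Fin N → ℝ), (∀ i, 0 ≤ d i) ∧
      W * (Wᴴ * W) = W ∧ V * Vᴴ = 1 ∧ Vᴴ * V = 1 ∧
      A = W * diagonal (fun i => (d i : ℂ)) * Vᴴ ∧
      Wᴴ * A * V = diagonal (fun i => (d i : ℂ)) ∧
      CFC.abs A = V * diagonal (fun i => (d i : ℂ)) * Vᴴ ∧
      ∀ p : ℝ≥0∞, p ≠ ∞ → schattenNorm p A = (∑ i, d i ^ p.toReal) ^ (1 / p.toReal) := by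
  have hpos : 0 ≤ CFC.abs A := CFC.abs_nonneg A
  have hpsd := nonneg_iff_posSemidef.mp hpos
  have hH := hpsd.1
  set d := hH.eigenvalues with hd
  set V : Matrix (Fin N) (Fin N) ℂ := (hH.eigenvectorUnitary : Matrix (Fin N) (Fin N) ℂ) with hV
  have hVV : V * Vᴴ = 1 := Unitary.coe_mul_star_self hH.eigenvectorUnitary
  have hVV' : Vᴴ * V = 1 := Unitary.coe_star_mul_self hH.eigenvectorUnitary
  set D : Matrix (Fin N) (Fin N) ℂ := diagonal (fun i => (d i : ℂ)) with hD
  -- The convention `0⁻¹ = 0` is what makes `E` the pseudo-inverse.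
  set E : Matrix (Fin N) (Fin N) ℂ := diagonal (fun i => ((d i)⁻¹ : ℂ)) with hE
  have hDh : Dᴴ = D := by
    simp only [hD, diagonal_conjTranspose]; congr 1; ext i; simp
  have hEh : Eᴴ = E := by
    simp only [hE, diagonal_conjTranspose]; congr 1; ext i; simp
  have hDED : D * E * D = D := by
    simp only [hD, hE, diagonal_mul_diagonal]
    congr 1; ext i
    by_cases h : (d i : ℂ) = 0 <;> simp [h]
  have hEDE : E * D * E = E := by
    simp only [hD, hE, diagonal_mul_diagonal]
    congr 1; ext i
    by_cases h : (d i : ℂ) = 0 <;> simp [h]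
  have hcomm : D * E = E * D := by
    simp only [hD, hE, diagonal_mul_diagonal, mul_comm]
  have habs : CFC.abs A = V * D * Vᴴ := by
    have := hH.spectral_theorem
    rw [Unitary.conjStarAlgAut_apply] at this
    exact this
  have hAA : Aᴴ * A = V * (D * D) * Vᴴ := by
    have h1 : CFC.abs A * CFC.abs A = Aᴴ * A := CFC.abs_mul_abs A
    rw [← h1, habs]
    simp only [mul_assoc]
    rw [← mul_assoc Vᴴ V, hVV', one_mul]
  have hVAAV : Vᴴ * Aᴴ * (A * V) = D * D := by
    calc Vᴴ * Aᴴ * (A * V) = Vᴴ * (Aᴴ * A) * V := by simp only [mul_assoc]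
      _ = (Vᴴ * V) * (D * D) * (Vᴴ * V) := by rw [hAA]; simp only [mul_assoc]
      _ = _ := by simp [hVV']
  have hWW : (A * V * E)ᴴ * (A * V * E) = E * D := by
    calc (A * V * E)ᴴ * (A * V * E) = E * (Vᴴ * Aᴴ * (A * V)) * E := by
          simp only [conjTranspose_mul, hEh, mul_assoc]
      _ = E * D * (D * E) := by rw [hVAAV]; simp only [mul_assoc]
      _ = E * D * (E * D) := by rw [hcomm]
      _ = E * D * E * D := by simp only [mul_assoc]
      _ = E * D := by rw [hEDE]
  -- The columns of `A V` with `d i = 0` vanish, because `(A V)* (A V) = D²`.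
  have hAV : A * V = A * V * E * D := by
    rw [← sub_eq_zero, ← conjTranspose_mul_self_eq_zero]
    have : A * V - A * V * E * D = A * V * (1 - E * D) := by
      rw [mul_sub, mul_one]; simp only [mul_assoc]
    rw [this, conjTranspose_mul, conjTranspose_mul]
    have h2 : D * D * (1 - E * D) = 0 := by
      rw [mul_sub, mul_one, mul_assoc D D, ← mul_assoc D E D, hDED, sub_self]
    calc (1 - E * D)ᴴ * (Vᴴ * Aᴴ) * (A * V * (1 - E * D))
        = (1 - E * D)ᴴ * ((Vᴴ * Aᴴ * (A * V)) * (1 - E * D)) := by simp only [mul_assoc]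
      _ = 0 := by rw [hVAAV, h2, mul_zero]
  refine ⟨A * V * E, V, d, hpsd.eigenvalues_nonneg, ?_, hVV, hVV', ?_, ?_, habs, ?_⟩
  · rw [hWW, ← hcomm, mul_assoc (A * V), ← mul_assoc E, hEDE]
  · rw [← hAV, mul_assoc, hVV, mul_one]
  · calc (A * V * E)ᴴ * A * V = (A * V * E)ᴴ * (A * V) := mul_assoc _ _ _
      _ = (A * V * E)ᴴ * (A * V * E * D) := by rw [← hAV]
      _ = D := by rw [← mul_assoc, hWW, ← hcomm, hDED]
  · intro p hp
    rw [schattenNorm, if_neg hp]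
    congr 1
    have h1 : CFC.rpow (CFC.abs A) p.toReal = cfc (fun x : ℝ => x ^ p.toReal) (CFC.abs A) :=
      CFC.rpow_eq_cfc_real hpos
    rw [h1, hH.cfc_eq, IsHermitian.cfc, Unitary.conjStarAlgAut_apply, Matrix.trace_mul_comm,
      ← mul_assoc]
    have h2 : (star hH.eigenvectorUnitary : Matrix (Fin N) (Fin N) ℂ) * hH.eigenvectorUnitary = 1 :=
      hVV'
    erw [h2]
    rw [one_mul, trace_diagonal, Complex.re_sum]
    simp [hd]

end SVD

/-! ### Domination of singular values -/

section Contraction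
open scoped ComplexOrder

variable {N : ℕ} {T : Matrix (Fin N) (Fin N) ℂ →ₗ[ℂ] Matrix (Fin N) (Fin N) ℂ}

/-- Cauchy–Schwarz in additive form: expand `|AP - CQ|² + |BP - DQ|² ≥ 0` for the Gram factors. -/
theorem IsCompletelyPositive.two_mul_re_le (hT : IsCompletelyPositive T)
    (X Y P Q : Matrix (Fin N) (Fin N) ℂ) (j : Fin N) :
    2 * ((Pᴴ * T (X * Yᴴ) * Q) j j).re ≤
      ((Pᴴ * T (X * Xᴴ) * P) j j).re + ((Qᴴ * T (Y * Yᴴ) * Q) j j).re := by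
  obtain ⟨A, B, C, D, h1, h2, -, h4⟩ := hT.exists_gram X Y
  have hG := ((posSemidef_conjTranspose_mul_self (A * P - C * Q)).add
    (posSemidef_conjTranspose_mul_self (B * P - D * Q))).diag_nonneg (i := j)
  have hE : (A * P - C * Q)ᴴ * (A * P - C * Q) + (B * P - D * Q)ᴴ * (B * P - D * Q) =
      Pᴴ * T (X * Xᴴ) * P + Qᴴ * T (Y * Yᴴ) * Q
        - (Pᴴ * T (X * Yᴴ) * Q + (Pᴴ * T (X * Yᴴ) * Q)ᴴ) := by
    rw [h1, h2, h4]
    simp only [conjTranspose_mul, conjTranspose_sub, conjTranspose_add, conjTranspose_conjTranspose]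
    noncomm_ring
  rw [hE] at hG
  have := (Complex.nonneg_iff.mp hG).1
  simp only [Matrix.sub_apply, Matrix.add_apply, conjTranspose_apply, Complex.sub_re, Complex.add_re,
    RCLike.star_def, Complex.conj_re] at this
  linarith

theorem IsCompletelyPositive.map_conjTranspose (hT : IsCompletelyPositive T)
    (X : Matrix (Fin N) (Fin N) ℂ) : T Xᴴ = (T X)ᴴ := by
  obtain ⟨A, B, C, D, -, h2, h3, -⟩ := hT.exists_gram X 1
  rw [conjTranspose_one, mul_one] at h2
  rw [one_mul] at h3
  rw [h2, h3]
  simp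

theorem IsCompletelyPositive.posSemidef_map (hT : IsCompletelyPositive T)
    {A : Matrix (Fin N) (Fin N) ℂ} (hA : A.PosSemidef) : (T A).PosSemidef := by
  obtain ⟨X, rfl⟩ : ∃ X, A = Xᴴ * X := by
    open scoped MatrixOrder in
    exact CStarAlgebra.nonneg_iff_eq_star_mul_self.mp (nonneg_iff_posSemidef.mpr hA)
  obtain ⟨A, B, C, D, h1, -, -, -⟩ := hT.exists_gram Xᴴ 1
  rw [conjTranspose_conjTranspose] at h1
  rw [h1]
  exact (posSemidef_conjTranspose_mul_self A).add (posSemidef_conjTranspose_mul_self B)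

theorem re_diag_nonneg {A : Matrix (Fin N) (Fin N) ℂ} (hA : A.PosSemidef) (j : Fin N) :
    0 ≤ (A j j).re :=
  (Complex.nonneg_iff.mp hA.diag_nonneg).1

theorem mul_single_mul_conjTranspose_mul_single (W V : Matrix (Fin N) (Fin N) ℂ) (i : Fin N) :
    (W * single i i (1 : ℂ)) * (V * single i i 1)ᴴ = W * single i i 1 * Vᴴ := by
  rw [conjTranspose_mul, conjTranspose_single, star_one, mul_assoc W, ← mul_assoc (single i i _),
    single_mul_single_same, mul_one, ← mul_assoc]

theorem mul_diagonal_mul_conjTranspose (W V : Matrix (Fin N) (Fin N) ℂ) (d : Fin N → ℂ) :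
    W * diagonal d * Vᴴ = ∑ i, d i • ((W * single i i 1) * (V * single i i 1)ᴴ) := by
  simp_rw [mul_single_mul_conjTranspose_mul_single]
  rw [← sum_single_eq_diagonal, Finset.mul_sum, Finset.sum_mul]
  refine Finset.sum_congr rfl fun i _ => ?_
  rw [← smul_mul_assoc, ← mul_smul_comm, smul_single, smul_eq_mul, mul_one]

/-- The matrix elements of a completely positive map between the rank one operators of the
columns of `W` and the columns of `W'`. -/
noncomputable def transitionWeight (T : Matrix (Fin N) (Fin N) ℂ →ₗ[ℂ] Matrix (Fin N) (Fin N) ℂ)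
    (W W' : Matrix (Fin N) (Fin N) ℂ) (j i : Fin N) : ℝ :=
  ((W'ᴴ * T ((W * single i i 1) * (W * single i i 1)ᴴ) * W') j j).re

theorem transitionWeight_nonneg (hT : IsCompletelyPositive T) (W W' : Matrix (Fin N) (Fin N) ℂ)
    (j i : Fin N) : 0 ≤ transitionWeight T W W' j i :=
  re_diag_nonneg ((hT.posSemidef_map
    (posSemidef_self_mul_conjTranspose _)).conjTranspose_mul_mul_same W') j

/-- `W W* ≤ 1` gives `T (W W*) ≤ T 1 = 1`; compressing by `W'` leaves at most `W'* W' ≤ 1`. -/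
theorem sum_transitionWeight_le_one (hT : IsCompletelyPositive T) (h1 : T 1 = 1)
    {W W' : Matrix (Fin N) (Fin N) ℂ} (hW : IsMatrixContraction W) (hW' : IsMatrixContraction W')
    (j : Fin N) : ∑ i, transitionWeight T W W' j i ≤ 1 := by
  have h : ∑ i, transitionWeight T W W' j i = ((W'ᴴ * T (W * Wᴴ) * W') j j).re := by
    have hs := mul_diagonal_mul_conjTranspose W W 1
    simp only [diagonal_one', mul_one, Pi.one_apply, one_smul] at hs
    rw [hs, map_sum, Finset.mul_sum, Finset.sum_mul,
      Matrix.sum_apply, Complex.re_sum]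
    rfl
  have h2 := re_diag_nonneg ((hT.posSemidef_map hW.1).conjTranspose_mul_mul_same W') j
  have h3 := re_diag_nonneg hW'.2 j
  rw [map_sub, h1, mul_sub, sub_mul, mul_one] at h2
  simp only [Matrix.sub_apply, one_apply_eq, Complex.sub_re, Complex.one_re] at h2 h3
  linarith

/-- The sum is a trace, which compression by `W'` can only decrease; trace preservation then leaves
`(W* W) i i ≤ 1`. -/
theorem sum_transitionWeight_le_one' (hT : IsCompletelyPositive T)
    (htr : ∀ A, (T A).trace = A.trace)
    {W W' : Matrix (Fin N) (Fin N) ℂ} (hW : IsMatrixContraction W) (hW' : IsMatrixContraction W')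
    (i : Fin N) : ∑ j, transitionWeight T W W' j i ≤ 1 := by
  set X := W * single i i (1 : ℂ) with hX
  have h : ∑ j, transitionWeight T W W' j i = (W'ᴴ * T (X * Xᴴ) * W').trace.re := by
    rw [Matrix.trace, Complex.re_sum]
    rfl
  obtain ⟨Z, hZ⟩ : ∃ Z, T (X * Xᴴ) = Zᴴ * Z := by
    open scoped MatrixOrder in
    exact CStarAlgebra.nonneg_iff_eq_star_mul_self.mp
      (nonneg_iff_posSemidef.mpr (hT.posSemidef_map (posSemidef_self_mul_conjTranspose X)))
  have h2 := (Complex.nonneg_iff.mp (hW'.1.mul_mul_conjTranspose_same Z).trace_nonneg).1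
  have h3 : (Z * W' * W'ᴴ * Zᴴ).trace = (W'ᴴ * T (X * Xᴴ) * W').trace := by
    rw [hZ, mul_assoc (Z * W'), trace_mul_comm]
    simp only [mul_assoc]
  have h4 : (Z * Zᴴ).trace = (Wᴴ * W) i i := by
    rw [trace_mul_comm, ← hZ, htr, trace_mul_comm, hX, conjTranspose_mul, conjTranspose_single,
      star_one, mul_assoc, ← mul_assoc Wᴴ, ← mul_assoc, single_mul_mul_single]
    simp
  have h5 := re_diag_nonneg hW.2 i
  rw [mul_sub, sub_mul, mul_one, trace_sub, ← mul_assoc, h3, h4] at h2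
  simp only [Matrix.sub_apply, one_apply_eq, Complex.sub_re, Complex.one_re] at h2 h5
  linarith

theorem exists_doubly_substochastic (hT : IsCompletelyPositive T) (h1 : T 1 = 1)
    (htr : ∀ A, (T A).trace = A.trace) {W V W' V' : Matrix (Fin N) (Fin N) ℂ}
    (hW : IsMatrixContraction W) (hV : IsMatrixContraction V)
    (hW' : IsMatrixContraction W') (hV' : IsMatrixContraction V') :
    ∃ c : Fin N → Fin N → ℝ, (∀ j i, 0 ≤ c j i) ∧ (∀ j, ∑ i, c j i ≤ 1) ∧
      (∀ i, ∑ j, c j i ≤ 1) ∧ ∀ d : Fin N → ℝ, (∀ i, 0 ≤ d i) → ∀ j,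
        ((W'ᴴ * T (W * diagonal (fun i => (d i : ℂ)) * Vᴴ) * V') j j).re ≤ ∑ i, c j i * d i := by
  -- The average of the two weights is the right side of the additive Cauchy–Schwarz bound.
  refine ⟨fun j i => (transitionWeight T W W' j i + transitionWeight T V V' j i) / 2,
    fun j i => ?_, fun j => ?_, fun i => ?_, fun d hd j => ?_⟩
  · have := transitionWeight_nonneg hT W W' j i
    have := transitionWeight_nonneg hT V V' j i
    positivity
  · have := sum_transitionWeight_le_one hT h1 hW hW' j
    have := sum_transitionWeight_le_one hT h1 hV hV' j
    rw [← Finset.sum_div, Finset.sum_add_distrib]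
    linarith
  · have := sum_transitionWeight_le_one' hT htr hW hW' i
    have := sum_transitionWeight_le_one' hT htr hV hV' i
    rw [← Finset.sum_div, Finset.sum_add_distrib]
    linarith
  · rw [mul_diagonal_mul_conjTranspose, map_sum, Finset.mul_sum, Finset.sum_mul, Matrix.sum_apply, Complex.re_sum]
    refine Finset.sum_le_sum fun i _ => ?_
    rw [map_smul, mul_smul_comm, smul_mul_assoc, Matrix.smul_apply, smul_eq_mul, Complex.re_ofReal_mul,
      mul_comm]
    refine mul_le_mul_of_nonneg_right ?_ (hd i)
    have := hT.two_mul_re_le (W * single i i 1) (V * single i i 1) W' V' j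
    simp only [transitionWeight]
    linarith

end Contraction

/-! ### Contraction in Schatten norms and its rigidity at the identity -/

section Norms
open scoped MatrixOrder ComplexOrder

variable {N : ℕ} {T : Matrix (Fin N) (Fin N) ℂ →ₗ[ℂ] Matrix (Fin N) (Fin N) ℂ}

open scoped Matrix.Norms.L2Operator in
theorem norm_le_one_of_mul_conjTranspose_mul {W : Matrix (Fin N) (Fin N) ℂ}
    (h : W * (Wᴴ * W) = W) : ‖W‖ ≤ 1 := by
  have h1 : ‖Wᴴ * W‖ = ‖W‖ * ‖W‖ := l2_opNorm_conjTranspose_mul_self W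
  have h2 : (Wᴴ * W)ᴴ * (Wᴴ * W) = Wᴴ * W := by
    rw [conjTranspose_mul, conjTranspose_conjTranspose, mul_assoc, h]
  have h3 := l2_opNorm_conjTranspose_mul_self (Wᴴ * W)
  rw [h2, h1] at h3
  by_contra! hlt
  nlinarith [mul_pos (zero_lt_one.trans hlt) (zero_lt_one.trans hlt), one_lt_mul_of_lt_of_le hlt hlt.le]

open scoped Matrix.Norms.L2Operator in
theorem schattenNorm_top_eq_norm {A W V : Matrix (Fin N) (Fin N) ℂ} {d : Fin N → ℝ}
    (hW : W * (Wᴴ * W) = W) (hV : Vᴴ * V = 1)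
    (hA : A = W * diagonal (fun i => (d i : ℂ)) * Vᴴ)
    (hd : Wᴴ * A * V = diagonal (fun i => (d i : ℂ))) : schattenNorm ∞ A = ‖d‖ := by
  have hW1 := norm_le_one_of_mul_conjTranspose_mul hW
  have hV1 : ‖V‖ ≤ 1 := norm_le_one_of_mul_conjTranspose_mul (by rw [hV, mul_one])
  have hdn : ‖diagonal (fun i => (d i : ℂ))‖ = ‖d‖ := by
    rw [l2_opNorm_diagonal]
    simp [Pi.norm_def, nnnorm]
  rw [schattenNorm, if_pos rfl]
  change ‖A‖ = _
  rw [← hdn]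
  have hWh : ‖Wᴴ‖ ≤ 1 := by rwa [l2_opNorm_conjTranspose]
  have hVh : ‖Vᴴ‖ ≤ 1 := by rwa [l2_opNorm_conjTranspose]
  apply le_antisymm
  · calc ‖A‖ ≤ ‖W‖ * ‖diagonal (fun i => (d i : ℂ))‖ * ‖Vᴴ‖ := by
          conv_lhs => rw [hA]
          exact (norm_mul_le _ _).trans (mul_le_mul_of_nonneg_right (norm_mul_le _ _) (norm_nonneg _))
      _ ≤ 1 * ‖diagonal (fun i => (d i : ℂ))‖ * 1 := by gcongr
      _ = _ := by ring
  · calc ‖diagonal (fun i => (d i : ℂ))‖ ≤ ‖Wᴴ‖ * ‖A‖ * ‖V‖ := by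
          rw [← hd]
          exact (norm_mul_le _ _).trans (mul_le_mul_of_nonneg_right (norm_mul_le _ _) (norm_nonneg _))
      _ ≤ 1 * ‖A‖ * 1 := by gcongr
      _ = _ := by ring

theorem schattenNorm_nonneg (p : ℝ≥0∞) (A : Matrix (Fin N) (Fin N) ℂ) : 0 ≤ schattenNorm p A := by
  by_cases hp : p = ∞
  · rw [schattenNorm, if_pos hp]
    exact norm_nonneg _
  · obtain ⟨W, V, d, hd, -, -, -, -, -, -, h⟩ := exists_singularValue_decomposition A
    rw [h p hp]
    exact Real.rpow_nonneg (Finset.sum_nonneg fun i _ => Real.rpow_nonneg (hd i) _) _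

/-- Jensen for weights of total mass at most 1: Hölder costs a factor `(∑ w) ^ (1 - q⁻¹) ≤ 1`. -/
theorem rpow_sum_le_sum_rpow_of_sum_le_one {ι : Type*} (s : Finset ι) {w f : ι → ℝ} {q : ℝ}
    (hq : 1 ≤ q) (hw : ∀ i, 0 ≤ w i) (hf : ∀ i, 0 ≤ f i) (hs : ∑ i ∈ s, w i ≤ 1) :
    (∑ i ∈ s, w i * f i) ^ q ≤ ∑ i ∈ s, w i * f i ^ q := by
  have hq0 : 0 < q := by linarith
  have h := Real.inner_le_weight_mul_Lp_of_nonneg s hq w f hw hf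
  have hw0 : 0 ≤ ∑ i ∈ s, w i := Finset.sum_nonneg fun i _ => hw i
  have hS : 0 ≤ ∑ i ∈ s, w i * f i ^ q :=
    Finset.sum_nonneg fun i _ => mul_nonneg (hw i) (Real.rpow_nonneg (hf i) _)
  have h1 : (∑ i ∈ s, w i) ^ (1 - q⁻¹) ≤ 1 :=
    Real.rpow_le_one hw0 hs (sub_nonneg.mpr (inv_le_one_of_one_le₀ hq))
  have h2 : ∑ i ∈ s, w i * f i ≤ (∑ i ∈ s, w i * f i ^ q) ^ q⁻¹ :=
    h.trans (mul_le_of_le_one_left (Real.rpow_nonneg hS _) h1)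
  calc _ ≤ ((∑ i ∈ s, w i * f i ^ q) ^ q⁻¹) ^ q :=
        Real.rpow_le_rpow (Finset.sum_nonneg fun i _ => mul_nonneg (hw i) (hf i)) h2 hq0.le
    _ = _ := Real.rpow_inv_rpow hS hq0.ne'

theorem one_le_toReal {p : ℝ≥0∞} (hp : 1 ≤ p) (hp' : p ≠ ∞) : 1 ≤ p.toReal := by
  simpa using ENNReal.toReal_mono hp' hp

theorem IsCompletelyPositive.schattenNorm_map_le (hT : IsCompletelyPositive T) (h1 : T 1 = 1)
    (htr : ∀ A, (T A).trace = A.trace) {p : ℝ≥0∞} (hp : 1 ≤ p) (A : Matrix (Fin N) (Fin N) ℂ) :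
    schattenNorm p (T A) ≤ schattenNorm p A := by
  obtain ⟨W, V, d, hd, hW, hV, hV2, hA, hdA, -, hn⟩ := exists_singularValue_decomposition A
  obtain ⟨W', V', d', hd', hW', hV', hV2', hA', hdA', -, hn'⟩ :=
    exists_singularValue_decomposition (T A)
  obtain ⟨c, hc, hc1, hc2, hcd⟩ := exists_doubly_substochastic hT h1 htr
    (isMatrixContraction_of_mul_conjTranspose_mul hW)
    (isMatrixContraction_of_mul_conjTranspose_mul (W := V) (by rw [hV2, mul_one]))
    (isMatrixContraction_of_mul_conjTranspose_mul hW')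
    (isMatrixContraction_of_mul_conjTranspose_mul (W := V') (by rw [hV2', mul_one]))
  have hle : ∀ j, d' j ≤ ∑ i, c j i * d i := fun j => by
    have := hcd d hd j
    rw [← hA, hdA', diagonal_apply_eq, Complex.ofReal_re] at this
    exact this
  by_cases hp' : p = ∞
  · subst hp'
    rw [schattenNorm_top_eq_norm hW hV2 hA hdA, schattenNorm_top_eq_norm hW' hV2' hA' hdA']
    refine (pi_norm_le_iff_of_nonneg (norm_nonneg _)).mpr fun j => ?_
    rw [Real.norm_of_nonneg (hd' j)]
    calc d' j ≤ ∑ i, c j i * d i := hle j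
      _ ≤ ∑ i, c j i * ‖d‖ := Finset.sum_le_sum fun i _ => mul_le_mul_of_nonneg_left
          ((Real.le_norm_self _).trans (norm_le_pi_norm d i)) (hc j i)
      _ = (∑ i, c j i) * ‖d‖ := (Finset.sum_mul ..).symm
      _ ≤ ‖d‖ := mul_le_of_le_one_left (norm_nonneg _) (hc1 j)
  · have hq := one_le_toReal hp hp'
    rw [hn p hp', hn' p hp']
    refine Real.rpow_le_rpow (Finset.sum_nonneg fun i _ => Real.rpow_nonneg (hd' i) _) ?_
      (by positivity)
    -- Row sums enter through Jensen, column sums after exchanging the summations.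
    calc ∑ j, d' j ^ p.toReal ≤ ∑ j, ∑ i, c j i * d i ^ p.toReal :=
          Finset.sum_le_sum fun j _ => (Real.rpow_le_rpow (hd' j) (hle j) (by positivity)).trans
            (rpow_sum_le_sum_rpow_of_sum_le_one _ hq (hc j) hd (hc1 j))
      _ = ∑ i, (∑ j, c j i) * d i ^ p.toReal := by
          rw [Finset.sum_comm]
          simp_rw [Finset.sum_mul]
      _ ≤ ∑ i, d i ^ p.toReal := Finset.sum_le_sum fun i _ =>
          mul_le_of_le_one_left (Real.rpow_nonneg (hd i) _) (hc2 i)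

theorem schattenOpNorm_le_one_iff {p : ℝ≥0∞} :
    schattenOpNorm p T ≤ 1 ↔ ∀ A, schattenNorm p (T A) ≤ schattenNorm p A := by
  simp only [schattenOpNorm, iSup_le_iff]
  refine forall_congr' fun A => ?_
  rw [ENNReal.div_le_iff_le_mul (.inr ENNReal.one_ne_top) (.inr one_ne_zero), one_mul,
    ENNReal.ofReal_le_ofReal_iff (schattenNorm_nonneg _ _)]
  refine ⟨fun h => ?_, fun h _ => h⟩
  by_cases hA : A = 0
  · simp [hA]
  · exact h hA

theorem schattenNorm_one {p : ℝ≥0∞} (hp : p ≠ ∞) :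
    schattenNorm p (1 : Matrix (Fin N) (Fin N) ℂ) = (N : ℝ) ^ (1 / p.toReal) := by
  have h : CFC.rpow (CFC.abs (1 : Matrix (Fin N) (Fin N) ℂ)) p.toReal = 1 := by
    rw [CFC.abs_one]
    exact CFC.one_rpow
  rw [schattenNorm, if_neg hp, h]
  simp

theorem eq_one_of_schattenNorm_le {B : Matrix (Fin N) (Fin N) ℂ} (hB : B.PosSemidef)
    (htr : B.trace = N) {p : ℝ≥0∞} (hp : 1 < p) (h : schattenNorm p B ≤ schattenNorm p (1 : Matrix (Fin N) (Fin N) ℂ)) :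
    B = 1 := by
  obtain ⟨W, V, d, hd, hW, hV, hV2, hA, hdA, habs, hn⟩ := exists_singularValue_decomposition B
  have hBV : B = V * diagonal (fun i => (d i : ℂ)) * Vᴴ := by
    rw [← habs]
    exact (CFC.abs_of_nonneg B (nonneg_iff_posSemidef.mpr hB)).symm
  have hsum : ∑ i, d i = N := by
    rw [hBV, trace_mul_comm, ← mul_assoc, hV2, one_mul, trace_diagonal] at htr
    exact_mod_cast htr
  suffices hd1 : ∀ i, d i = 1 by
    rw [hBV]
    simp [hd1, hV]
  by_cases hp' : p = ∞
  · subst hp'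
    have h1 : ‖d‖ ≤ 1 := by
      rw [← schattenNorm_top_eq_norm hW hV2 hA hdA]
      refine h.trans ?_
      rw [schattenNorm, if_pos rfl, map_one]
      exact ContinuousLinearMap.norm_id_le
    have h2 : ∀ i, d i ≤ 1 := fun i =>
      (Real.le_norm_self _).trans ((norm_le_pi_norm d i).trans h1)
    have h3 := (Finset.sum_eq_sum_iff_of_le (s := Finset.univ) (f := d) (g := fun _ => (1 : ℝ))
      fun i _ => h2 i).mp (by simp [hsum])
    exact fun i => h3 i (Finset.mem_univ i)
  · have hq : 1 < p.toReal := by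
      simpa using (ENNReal.toReal_lt_toReal ENNReal.one_ne_top hp').mpr hp
    rw [hn p hp', schattenNorm_one hp', Real.rpow_le_rpow_iff
      (Finset.sum_nonneg fun i _ => Real.rpow_nonneg (hd i) _) (Nat.cast_nonneg N)
      (by positivity)] at h
    -- Bernoulli: the tangent line of `x ^ p` at 1. Its values sum to `N` by the trace condition, so
    -- equality holds for every `i`, which forces `d i = 1`.
    have hle : ∀ i, 1 + p.toReal * (d i - 1) ≤ d i ^ p.toReal := fun i => by
      simpa using one_add_mul_self_le_rpow_one_add (s := d i - 1) (by linarith [hd i]) hq.le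
    have hs : ∑ i, (1 + p.toReal * (d i - 1)) = N := by
      rw [Finset.sum_add_distrib, ← Finset.mul_sum, Finset.sum_sub_distrib, hsum]
      simp
    have h3 := (Finset.sum_eq_sum_iff_of_le (s := Finset.univ) fun i _ => hle i).mp
      (le_antisymm (Finset.sum_le_sum fun i _ => hle i) (by rw [hs]; exact h))
    intro i
    by_contra hne
    have := one_add_mul_self_lt_rpow_one_add (s := d i - 1) (by linarith [hd i])
      (sub_ne_zero.mpr hne) hq
    rw [h3 i (Finset.mem_univ i)] at this
    simp at this

theorem IsCompletelyPositive.map_one_eq_one (hT : IsCompletelyPositive T)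
    (htr : ∀ A, (T A).trace = A.trace) {p : ℝ≥0∞} (hp : 1 < p) (h : schattenOpNorm p T ≤ 1) :
    T 1 = 1 :=
  eq_one_of_schattenNorm_le (hT.posSemidef_map PosSemidef.one) (by simp [htr]) hp
    (schattenOpNorm_le_one_iff.mp h 1)

theorem schattenNorm_two_sq (A : Matrix (Fin N) (Fin N) ℂ) :
    schattenNorm 2 A ^ 2 = (Aᴴ * A).trace.re := by
  obtain ⟨W, V, d, hd, -, -, hV2, -, -, habs, hn⟩ := exists_singularValue_decomposition A
  have h1 : Aᴴ * A = CFC.abs A * CFC.abs A := (CFC.abs_mul_abs A).symm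
  have h2 : (Aᴴ * A).trace.re = ∑ i, d i ^ 2 := by
    rw [h1, habs, trace_mul_comm]
    simp only [mul_assoc]
    rw [trace_mul_comm, ← mul_assoc Vᴴ V, hV2, one_mul]
    simp only [mul_assoc]
    rw [hV2, mul_one, diagonal_mul_diagonal, trace_diagonal, Complex.re_sum]
    simp [sq]
  rw [h2, hn 2 (by simp), ENNReal.toReal_ofNat, ← Real.sqrt_eq_rpow]
  simp_rw [Real.rpow_two]
  rw [Real.sq_sqrt (Finset.sum_nonneg fun i _ => sq_nonneg _)]

end Norms

/-! ### From the generator to the semigroup and back -/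

section Semigroup

variable {N : ℕ} {T : ℝ≥0 → Matrix (Fin N) (Fin N) ℂ →ₗ[ℂ] Matrix (Fin N) (Fin N) ℂ}
  {L : Matrix (Fin N) (Fin N) ℂ →ₗ[ℂ] Matrix (Fin N) (Fin N) ℂ}

theorem IsGenerator.apply_eq_zero (hL : IsGenerator T L) {x : Matrix (Fin N) (Fin N) ℂ}
    (h : ∀ t, T t x = x) : L x = 0 := by
  refine tendsto_nhds_unique (hL x) ?_
  simp [h]

/-- The orbit of `x` is continuous with right derivative `T s (L x) = 0`, and a zero right
derivative already forces constancy. -/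
theorem IsQDS.apply_eq_of_generator_eq_zero (hT : IsQDS T) (hL : IsGenerator T L)
    {x : Matrix (Fin N) (Fin N) ℂ} (h : L x = 0) (t : ℝ≥0) : T t x = x := by
  ext i j
  let f : ℝ → ℂ := fun s => T s.toNNReal x i j
  have hf : Continuous f :=
    (((hT.continuous x).comp continuous_real_toNNReal).matrix_elem i j)
  have hd : ∀ s ∈ Set.Ico (0 : ℝ) t, HasDerivWithinAt f 0 (Set.Ici s) s := by
    intro s hs
    have hLc : Continuous fun y : Matrix (Fin N) (Fin N) ℂ => T s.toNNReal y i j :=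
      (LinearMap.continuous_of_finiteDimensional (T s.toNNReal)).matrix_elem i j
    have h1 := (hLc.tendsto _).comp (hL x)
    have h2 : Tendsto (fun r : ℝ => (r - s).toNNReal) (𝓝[>] s) (𝓝[>] 0) := by
      refine tendsto_nhdsWithin_iff.mpr ⟨?_, ?_⟩
      · have : Tendsto (fun r : ℝ => (r - s).toNNReal) (𝓝 s) (𝓝 (s - s).toNNReal) :=
          (continuous_real_toNNReal.comp (continuous_id.sub continuous_const)).tendsto s
        rw [sub_self, Real.toNNReal_zero] at this
        exact this.mono_left nhdsWithin_le_nhds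
      · filter_upwards [self_mem_nhdsWithin] with r hr
        exact Real.toNNReal_pos.mpr (sub_pos.mpr hr)
    have h3 := h1.comp h2
    rw [h, _root_.map_zero, Matrix.zero_apply] at h3
    rw [← hasDerivWithinAt_Ioi_iff_Ici, hasDerivWithinAt_iff_tendsto_slope' (by simp)]
    refine h3.congr' ?_
    filter_upwards [self_mem_nhdsWithin] with r hr
    have hr' : (0 : ℝ) ≤ r - s := (sub_pos.mpr hr).le
    have hadd : r.toNNReal = s.toNNReal + (r - s).toNNReal := by
      rw [← Real.toNNReal_add hs.1 hr']
      congr 1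
      ring
    simp only [Function.comp, slope, vsub_eq_sub, f]
    rw [hadd, hT.map_add, Real.coe_toNNReal _ hr', ← Complex.coe_smul, map_smul, map_sub]
    simp [Matrix.smul_apply, Matrix.sub_apply]
  have := constant_of_has_deriv_right_zero hf.continuousOn hd t ⟨t.2, le_rfl⟩
  simpa [f, hT.map_zero] using this

theorem IsCompletelyPositive.trace_mul_map
    {S : Matrix (Fin N) (Fin N) ℂ →ₗ[ℂ] Matrix (Fin N) (Fin N) ℂ} (hS : IsCompletelyPositive S)
    (h1 : S 1 = 1) (htr : ∀ A, (S A).trace = A.trace)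
    {x : Matrix (Fin N) (Fin N) ℂ} (hx : x.IsHermitian) :
    (x * (S x - x)).trace.im = 0 ∧ (x * (S x - x)).trace.re ≤ 0 := by
  have hSx : (S x)ᴴ = S x := by rw [← hS.map_conjTranspose, hx]
  constructor
  · rw [← Complex.conj_eq_iff_im, ← RCLike.star_def, ← trace_conjTranspose, conjTranspose_mul,
      conjTranspose_sub, hSx, hx, trace_mul_comm]
  · have h2 := hS.schattenNorm_map_le h1 htr (p := 2) (by norm_num) x
    have h3 := pow_le_pow_left₀ (schattenNorm_nonneg _ _) h2 2
    rw [schattenNorm_two_sq, schattenNorm_two_sq, hSx, hx] at h3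
    -- Expanding gives `2 Tr (x S x) ≤ Tr (S x)² + Tr x²`, and contraction at `p = 2` bounds this by
    -- `2 Tr x²`.
    have h4 : 0 ≤ ((S x - x)ᴴ * (S x - x)).trace.re := by
      rw [← schattenNorm_two_sq]
      positivity
    rw [conjTranspose_sub, hSx, hx, sub_mul, mul_sub, mul_sub, trace_sub, trace_sub, trace_sub,
      trace_mul_comm (S x) x] at h4
    rw [mul_sub, trace_sub]
    simp only [Complex.sub_re] at h4 ⊢
    linarith

theorem IsGenerator.trace_mul_apply (hL : IsGenerator T L) {x : Matrix (Fin N) (Fin N) ℂ}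
    (h : ∀ t, (x * (T t x - x)).trace.im = 0 ∧ (x * (T t x - x)).trace.re ≤ 0) :
    (x * L x).trace.im = 0 ∧ (x * L x).trace.re ≤ 0 := by
  have hc : Continuous fun y : Matrix (Fin N) (Fin N) ℂ => (x * y).trace :=
    (continuous_const.matrix_mul continuous_id).matrix_trace
  have h1 : Tendsto (fun t : ℝ≥0 => (x * ((t : ℝ)⁻¹ • (T t x - x))).trace) (𝓝[>] 0)
      (𝓝 (x * L x).trace) := (hc.tendsto _).comp (hL x)
  simp_rw [mul_smul_comm, trace_smul] at h1
  constructor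
  · refine tendsto_nhds_unique ((Complex.continuous_im.tendsto _).comp h1) ?_
    simp [Function.comp_def, (h _).1]
  · refine le_of_tendsto ((Complex.continuous_re.tendsto _).comp h1) (.of_forall fun t => ?_)
    simpa using mul_nonpos_of_nonneg_of_nonpos (inv_nonneg.mpr t.2) (h t).2

end Semigroup

theorem mainTheorem12 (N : ℕ)
    (T : ℝ≥0 → Matrix (Fin N) (Fin N) ℂ →ₗ[ℂ] Matrix (Fin N) (Fin N) ℂ)
    (L : Matrix (Fin N) (Fin N) ℂ →ₗ[ℂ] Matrix (Fin N) (Fin N) ℂ)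
    (hT : IsQDS T) (hL : IsGenerator T L) :
    List.TFAE
      [∃ p : ℝ≥0∞, 1 < p ∧ ∀ t : ℝ≥0, schattenOpNorm p (T t) ≤ 1,
        ∀ p : ℝ≥0∞, 1 ≤ p → ∀ t : ℝ≥0, schattenOpNorm p (T t) ≤ 1,
        L 1 = 0] ∧
    (L 1 = 0 → ∀ x : Matrix (Fin N) (Fin N) ℂ, x.IsHermitian →
      (x * L x).trace.im = 0 ∧ (x * L x).trace.re ≤ 0) := by
  constructor
  · tfae_have 1 → 3 := by
      rintro ⟨p, hp, h⟩
      exact hL.apply_eq_zero fun t =>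
        (hT.completelyPositive t).map_one_eq_one (hT.trace_map t) hp (h t)
    tfae_have 3 → 2 := fun h p hp t => schattenOpNorm_le_one_iff.mpr
      ((hT.completelyPositive t).schattenNorm_map_le
        (hT.apply_eq_of_generator_eq_zero hL h t) (hT.trace_map t) hp)
    tfae_have 2 → 1 := fun h => ⟨2, ENNReal.one_lt_two, h 2 ENNReal.one_lt_two.le⟩
    tfae_finish
  · exact fun h x hx => hL.trace_mul_apply fun t => (hT.completelyPositive t).trace_mul_map
      (hT.apply_eq_of_generator_eq_zero hL h t) (hT.trace_map t) hx
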